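/- Let $d\ge 1$ be an integer. A dyadic interval is an interval $[j2^k,(j+1)2^k)$ with $j,k\in\mathbb Z$; let $\mathcal D$ be the set of all of them. A dyadic rectangle in $\mathbb R^d$ is a product $R=\prod_{j=1}^d R_{(j)}$ with all $R_{(j)}\in\mathcal D$. For $\lambda>0$, $\lambda R$ denotes the rectangle with the same center as $R$ and with each side $\lambda$ times as long. The shadow of a collection $\mathcal U$ of dyadic rectangles is $\mathrm{sh}(\mathcal U)=\bigcup_{R\in\mathcal U}R$, and $|A|$ is the Lebesgue measure of $A\subset\mathbb R^d$. For every $\epsilon>0$ there is a finite constant $C$, depending only on $d$ and $\epsilon$, such that for every collection $\mathcal U$ of dyadic rectangles in $\mathbb R^d$ with $|\mathrm{sh}(\mathcal U)|<\infty$ there are a measurable set $V\supset \mathrm{sh}(\mathcal U)$ with $|V|\le C\,|\mathrm{sh}(\mathcal U)|$, a map $\mathrm{emb}:\mathcal U\to[1,\infty)$ and a map $\imath:\mathcal U\to\{1,\dots,d\}$ such that $$\mathrm{emb}(R)\cdot R\subset V\qquad\text{for all }R\in\mathcal U,$$ and such that for all collections $\mathcal U'\subset\mathcal U$, $$\sum_{j=1}^d\sum_{v=0}^\infty\sum_{I\in\mathcal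 D}2^{-(d+\epsilon)v}\,|F(I,j,v,\mathcal U')|\le C\,|\mathrm{sh}(\mathcal U')|,$$ where $$F(I,j,v,\mathcal U')=\bigcup\{R\in\mathcal U'\,:\,2^v\le\mathrm{emb}(R)<2^{v+1},\ R_{(j)}=I,\ \imath(R)=j\}.$$ -/

import Mathlib

open MeasureTheory
open scoped ENNReal NNReal

/-- The dyadic interval `[index * 2 ^ scale, (index + 1) * 2 ^ scale)` of the real line,
coded by its scale and its index. The coding is one-to-one (`DyadicInterval.toSet_injective`). -/
structure DyadicInterval where
  scale : ℤ
  index : ℤ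

namespace DyadicInterval

/-- The length `2 ^ k` of the interval `[j 2 ^ k, (j + 1) 2 ^ k)`. -/
noncomputable def length (I : DyadicInterval) : ℝ := (2 : ℝ) ^ I.scale

/-- The interval as a set of reals, `[j 2 ^ k, (j + 1) 2 ^ k)`. -/
def toSet (I : DyadicInterval) : Set ℝ :=
  Set.Ico ((I.index : ℝ) * (2 : ℝ) ^ I.scale) (((I.index : ℝ) + 1) * (2 : ℝ) ^ I.scale)

/-- The midpoint of the interval. -/
noncomputable def center (I : DyadicInterval) : ℝ :=
  ((I.index : ℝ) + 1 / 2) * (2 : ℝ) ^ I.scale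

/-- The dilate: the (half-open) interval with the same center, of length `t` times that of `I`. -/
noncomputable def dilate (t : ℝ) (I : DyadicInterval) : Set ℝ :=
  Set.Ico (I.center - t * I.length / 2) (I.center + t * I.length / 2)

/-- Different codes give different intervals. -/
theorem toSet_injective : Function.Injective DyadicInterval.toSet := by
  rintro ⟨k, j⟩ ⟨k', j'⟩ h
  have hk : (0 : ℝ) < (2 : ℝ) ^ k := by positivity
  have hk' : (0 : ℝ) < (2 : ℝ) ^ k' := by positivity
  simp only [toSet] at h
  have hlt : (j : ℝ) * (2 : ℝ) ^ k < ((j : ℝ) + 1) * (2 : ℝ) ^ k := by nlinarith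
  have hlt' : (j' : ℝ) * (2 : ℝ) ^ k' < ((j' : ℝ) + 1) * (2 : ℝ) ^ k' := by nlinarith
  have h1 := congrArg sInf h
  have h2 := congrArg sSup h
  rw [csInf_Ico hlt, csInf_Ico hlt'] at h1
  rw [csSup_Ico hlt, csSup_Ico hlt'] at h2
  have h3 : (2 : ℝ) ^ k = (2 : ℝ) ^ k' := by linarith
  have h4 : k = k' := zpow_right_injective₀ (by norm_num) (by norm_num) h3
  subst h4
  have h5 : (j : ℝ) = j' := mul_right_cancel₀ hk.ne' h1
  have h6 : j = j' := by exact_mod_cast h5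
  subst h6
  rfl

/-- Dilation by the factor one does nothing. -/
theorem dilate_one (I : DyadicInterval) : I.dilate 1 = I.toSet := by
  unfold dilate toSet center length
  congr 1 <;> ring

end DyadicInterval

/-- A dyadic rectangle of `ℝ ^ d`, given by its `d` sides, which are dyadic intervals. -/
abbrev DyadicRect (d : ℕ) := Fin d → DyadicInterval

namespace DyadicRect

/-- The rectangle as a subset of `ℝ ^ d`: the product of its sides. -/
def toSet {d : ℕ} (R : DyadicRect d) : Set (Fin d → ℝ) :=
  Set.univ.pi fun i => (R i).toSet

/-- The dilate `t R`: the rectangle with the same center as `R`, all of whose sides are `t` times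
as long. -/
noncomputable def dilate {d : ℕ} (t : ℝ) (R : DyadicRect d) : Set (Fin d → ℝ) :=
  Set.univ.pi fun i => (R i).dilate t

/-- The shadow of a collection of rectangles: their union. -/
def shadow {d : ℕ} (U : Set (DyadicRect d)) : Set (Fin d → ℝ) :=
  ⋃ R ∈ U, R.toSet

/-- The set `F(I, j, v, U')`: the union of the rectangles `R ∈ U'` whose embeddedness satisfies
`2 ^ v ≤ emb R < 2 ^ (v + 1)`, whose `j`-th side is `I`, and whose selected coordinate is `j`. -/
def levelUnion {d : ℕ} (emb : DyadicRect d → ℝ) (sel : DyadicRect d → Fin d)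
    (I : DyadicInterval) (j : Fin d) (v : ℕ) (U' : Set (DyadicRect d)) : Set (Fin d → ℝ) :=
  shadow {R | R ∈ U' ∧ ((2 : ℝ) ^ v ≤ emb R ∧ emb R < (2 : ℝ) ^ (v + 1)) ∧ R j = I ∧ sel R = j}

end DyadicRect

/-! ### Dyadic intervals: nesting, ancestors, one-dimensional covering. -/

namespace DyadicInterval

/-! This is a Journé-type lemma, proved by a stopping time through a chain of enlargements. Put E_0
= sh(U), and let E_{n+1} be the union of the dyadic rectangles at least half filled by E_n. By
`volume_shadow_le`, a covering estimate obtained by Fubini and induction on the dimension, each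
|E_n| is at most a constant times |sh(U)|. For R in U, replace the first n sides by their v-th
ancestors and ask that the result lie in E_n for every n ≤ d. This holds for v = 0 and fails for
large v. If v = N + 1 is the first failure, set emb(R) = 2^N, and let the selected coordinate be the
one whose raise fails first. The fully raised rectangle at level N lies in E_d and its triple
contains 2^N R, so V is the union of the triples of the dyadic rectangles inside E_d. For the sum,
fix j and v and raise the coordinates before j by v + 1 generations. The resulting P lie in E_j,
while raising side j as well leaves less than half of the measure in E_j. Hence at least half of P
avoids the rectangles of the family with much longer j-th side, and what remains for different I
overlaps at most v + 1 times (`tsum_volume_shadow_le`). Passing back to the original rectangles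
costs 2^{(v+1)d}; the weight 2^{-(d+ε)v} absorbs this and the factor v + 1. -/

instance : Countable DyadicInterval :=
  Function.Injective.countable (f := fun I : DyadicInterval => (I.scale, I.index)) (by
    rintro ⟨k, j⟩ ⟨k', j'⟩ h
    simpa using h)

/-- Dyadic intervals are ordered by inclusion. -/
instance : PartialOrder DyadicInterval := PartialOrder.lift toSet toSet_injective

theorem mem_toSet_iff {I : DyadicInterval} {x : ℝ} :
    x ∈ I.toSet ↔ ⌊x / (2 : ℝ) ^ I.scale⌋ = I.index := by
  have h : (0 : ℝ) < (2 : ℝ) ^ I.scale := by positivity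
  rw [Int.floor_eq_iff, toSet, Set.mem_Ico, le_div_iff₀ h, div_lt_iff₀ h]

theorem length_pos (I : DyadicInterval) : 0 < I.length := by
  unfold length; positivity

theorem toSet_nonempty (I : DyadicInterval) : I.toSet.Nonempty := by
  have h : (0 : ℝ) < (2 : ℝ) ^ I.scale := by positivity
  exact Set.nonempty_Ico.2 (by nlinarith)

theorem measurableSet_toSet (I : DyadicInterval) : MeasurableSet I.toSet := measurableSet_Ico

theorem measurableSet_dilate (t : ℝ) (I : DyadicInterval) : MeasurableSet (I.dilate t) :=
  measurableSet_Ico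

theorem volume_toSet (I : DyadicInterval) : volume I.toSet = ENNReal.ofReal I.length := by
  rw [toSet, Real.volume_Ico, length]
  congr 1
  ring

theorem volume_dilate (t : ℝ) (I : DyadicInterval) :
    volume (I.dilate t) = ENNReal.ofReal (t * I.length) := by
  rw [dilate, Real.volume_Ico]
  congr 1
  ring

theorem volume_toSet_ne_zero (I : DyadicInterval) : volume I.toSet ≠ 0 := by
  rw [volume_toSet]
  simpa using I.length_pos

theorem volume_toSet_ne_top (I : DyadicInterval) : volume I.toSet ≠ ∞ := by
  rw [volume_toSet]
  exact ENNReal.ofReal_ne_top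

theorem eq_of_mem_of_scale_eq {I J : DyadicInterval} {x : ℝ} (hI : x ∈ I.toSet)
    (hJ : x ∈ J.toSet) (h : I.scale = J.scale) : I = J := by
  rw [mem_toSet_iff] at hI hJ
  rw [h, hJ] at hI
  cases I
  cases J
  simp_all

/-- The dyadic interval `n` generations above `I`, containing `I`. -/
def ancestor (n : ℕ) (I : DyadicInterval) : DyadicInterval := ⟨I.scale + n, I.index / 2 ^ n⟩

@[simp] theorem scale_ancestor (n : ℕ) (I : DyadicInterval) :
    (I.ancestor n).scale = I.scale + n := rfl

theorem length_ancestor (n : ℕ) (I : DyadicInterval) :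
    (I.ancestor n).length = 2 ^ n * I.length := by
  simp only [length, scale_ancestor]
  rw [zpow_add₀ (by norm_num), zpow_natCast, mul_comm]

theorem le_ancestor (n : ℕ) (I : DyadicInterval) : I ≤ I.ancestor n := by
  intro x hx
  rw [mem_toSet_iff] at hx ⊢
  have h : x / (2 : ℝ) ^ (I.ancestor n).scale = x / (2 : ℝ) ^ I.scale / ((2 ^ n : ℕ) : ℝ) := by
    rw [scale_ancestor, zpow_add₀ (by norm_num), zpow_natCast, div_div]
    push_cast
    rfl
  -- Taking floors commutes with dividing by 2^n, which is why the index of the ancestor is an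
  -- integer quotient.
  rw [h, Int.floor_div_natCast, hx]
  simp [ancestor]

theorem le_of_mem_of_scale_le {I J : DyadicInterval} {x : ℝ} (hI : x ∈ I.toSet)
    (hJ : x ∈ J.toSet) (h : I.scale ≤ J.scale) : I ≤ J := by
  have hJ' : J = I.ancestor (J.scale - I.scale).toNat :=
    eq_of_mem_of_scale_eq hJ (le_ancestor _ I hI) (by simp; omega)
  rw [hJ']
  exact le_ancestor _ I

theorem scale_le_of_le {I J : DyadicInterval} (h : I ≤ J) : I.scale ≤ J.scale := by
  obtain ⟨x, hx⟩ := I.toSet_nonempty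
  by_contra! hlt
  have : I = J := le_antisymm h (le_of_mem_of_scale_le (h hx) hx hlt.le)
  simp [this] at hlt

theorem ancestor_mono (n : ℕ) : Monotone (ancestor n) := by
  intro I J h
  obtain ⟨x, hx⟩ := I.toSet_nonempty
  refine le_of_mem_of_scale_le (le_ancestor n I hx) (le_ancestor n J (h hx)) ?_
  have := scale_le_of_le h
  simpa

theorem volume_ancestor (n : ℕ) (I : DyadicInterval) :
    volume (I.ancestor n).toSet = 2 ^ n * volume I.toSet := by
  rw [volume_toSet, volume_toSet, length_ancestor, ENNReal.ofReal_mul (by positivity),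
    ENNReal.ofReal_pow (by norm_num), ENNReal.ofReal_ofNat]

theorem center_mem_toSet (I : DyadicInterval) : I.center ∈ I.toSet := by
  have h : (0 : ℝ) < (2 : ℝ) ^ I.scale := by positivity
  constructor <;> unfold center <;> nlinarith

theorem toSet_eq_Ico_center (I : DyadicInterval) :
    I.toSet = Set.Ico (I.center - I.length / 2) (I.center + I.length / 2) := by
  simpa [dilate] using I.dilate_one.symm

theorem dilate_three_mono {I J : DyadicInterval} (h : I ≤ J) : I.dilate 3 ⊆ J.dilate 3 := by
  have h' : I.toSet ⊆ J.toSet := h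
  have hI := I.length_pos
  rw [toSet_eq_Ico_center, toSet_eq_Ico_center, Set.Ico_subset_Ico_iff (by linarith)] at h'
  exact Set.Ico_subset_Ico (by linarith) (by linarith)

/-- The dilate is as long as the ancestor, and its center lies in the ancestor, so it overshoots by
at most half a length on either side. -/
theorem dilate_subset_dilate_ancestor (n : ℕ) (I : DyadicInterval) :
    I.dilate (2 ^ n) ⊆ (I.ancestor n).dilate 3 := by
  have h := le_ancestor n I I.center_mem_toSet
  rw [toSet_eq_Ico_center, Set.mem_Ico] at h
  have hl := length_ancestor n I
  have := (I.ancestor n).length_pos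
  exact Set.Ico_subset_Ico (by linarith) (by linarith)

/-- A covering estimate: maximal members of a finite family of dyadic intervals are disjoint and
cover all the others. -/
theorem volume_biUnion_le {φ : DyadicInterval → Set ℝ} (hφ : Monotone φ) {S : Set DyadicInterval}
    {E : Set ℝ} (hE : MeasurableSet E) {K : ℝ≥0∞}
    (h : ∀ I ∈ S, volume (φ I) ≤ K * volume (I.toSet ∩ E)) :
    volume (⋃ I ∈ S, φ I) ≤ K * volume E := by
  classical
  have hfin : ∀ s : Finset DyadicInterval, (s : Set DyadicInterval) ⊆ S →
      volume (⋃ I ∈ s, φ I) ≤ K * volume E := by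
    intro s hs
    set m := s.filter (fun I => Maximal (· ∈ s) I) with hm
    have hcover : (⋃ I ∈ s, φ I) ⊆ ⋃ I ∈ m, φ I := by
      refine Set.iUnion₂_subset fun I hI => ?_
      obtain ⟨J, hIJ, hJ⟩ := s.exists_le_maximal hI
      exact (hφ hIJ).trans (Set.subset_biUnion_of_mem (u := φ)
        (Finset.mem_coe.2 (Finset.mem_filter.2 ⟨hJ.1, hJ⟩)))
    have hdisj : Set.PairwiseDisjoint (m : Set DyadicInterval) (fun I => I.toSet ∩ E) := by
      intro I hI J hJ hne
      have hI' := (Finset.mem_filter.1 (Finset.mem_coe.1 hI))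
      have hJ' := (Finset.mem_filter.1 (Finset.mem_coe.1 hJ))
      refine Set.disjoint_left.2 fun x hx hy => hne ?_
      rcases le_total I.scale J.scale with hs | hs
      · exact hI'.2.eq_of_le hJ'.1 (le_of_mem_of_scale_le hx.1 hy.1 hs)
      · exact (hJ'.2.eq_of_le hI'.1 (le_of_mem_of_scale_le hy.1 hx.1 hs)).symm
    calc volume (⋃ I ∈ s, φ I) ≤ volume (⋃ I ∈ m, φ I) := measure_mono hcover
      _ ≤ ∑ I ∈ m, volume (φ I) := measure_biUnion_finset_le _ _
      _ ≤ ∑ I ∈ m, K * volume (I.toSet ∩ E) :=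
          Finset.sum_le_sum fun I hI => h I (hs (Finset.mem_filter.1 hI).1)
      _ = K * volume (⋃ I ∈ m, I.toSet ∩ E) := by
          rw [← Finset.mul_sum, measure_biUnion_finset hdisj
            fun I _ => I.measurableSet_toSet.inter hE]
      _ ≤ K * volume E := by
          gcongr
          exact Set.iUnion₂_subset fun I _ => Set.inter_subset_right
  -- An infinite family may have no maximal members, so the bound passes from finite subfamilies by
  -- continuity from below.
  have hdir : Directed (· ⊆ ·) fun s : Finset S => ⋃ I ∈ s.image Subtype.val, φ I := by
    refine Monotone.directed_le (f := fun s : Finset S => ⋃ I ∈ s.image Subtype.val, φ I) ?_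
    intro s t hst
    exact Set.biUnion_subset_biUnion_left (Finset.image_subset_image hst)
  have hU : (⋃ I ∈ S, φ I) = ⋃ s : Finset S, ⋃ I ∈ s.image Subtype.val, φ I := by
    ext x
    simp only [Set.mem_iUnion, Finset.mem_image, Subtype.exists, exists_prop]
    constructor
    · rintro ⟨I, hI, hx⟩
      exact ⟨{⟨I, hI⟩}, I, ⟨I, hI, by simp, rfl⟩, hx⟩
    · rintro ⟨s, I, ⟨J, hJ, -, rfl⟩, hx⟩
      exact ⟨J, hJ, hx⟩
  rw [hU, hdir.measure_iUnion]
  refine iSup_le fun s => hfin _ fun I hI => ?_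
  obtain ⟨J, -, rfl⟩ := Finset.mem_image.1 (Finset.mem_coe.1 hI)
  exact J.2

end DyadicInterval

/-! ### Slicing off the first coordinate. -/

theorem Fin.cons_mem_univ_pi {d : ℕ} {f : Fin (d + 1) → Set ℝ} {t : ℝ} {y : Fin d → ℝ} :
    (Fin.cons t y : Fin (d + 1) → ℝ) ∈ Set.univ.pi f ↔
      t ∈ f 0 ∧ y ∈ Set.univ.pi (fun i => f i.succ) := by
  simp [Set.mem_pi, Fin.forall_fin_succ]

theorem measurable_finCons {d : ℕ} :
    Measurable (fun p : ℝ × (Fin d → ℝ) => (Fin.cons p.1 p.2 : Fin (d + 1) → ℝ)) :=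
  measurable_pi_iff.2 fun i => Fin.cases measurable_fst
    (fun j => (measurable_pi_apply j).comp measurable_snd) i

theorem volume_finCons_preimage {d : ℕ} (A : Set (Fin (d + 1) → ℝ)) :
    volume ((fun p : ℝ × (Fin d → ℝ) => (Fin.cons p.1 p.2 : Fin (d + 1) → ℝ)) ⁻¹' A) =
      volume A := by
  have h := (volume_preserving_piFinSuccAbove (fun _ : Fin (d + 1) => ℝ) 0).symm
  have h' := h.measure_preimage_equiv A
  rw [← h']
  congr 1
  ext p
  simp [MeasurableEquiv.piFinSuccAbove]
  rfl

theorem volume_eq_lintegral_fiber_tail {d : ℕ} {A : Set (Fin (d + 1) → ℝ)}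
    (hA : MeasurableSet A) :
    volume A = ∫⁻ t : ℝ, volume {y : Fin d → ℝ | (Fin.cons t y : Fin (d + 1) → ℝ) ∈ A} := by
  rw [← volume_finCons_preimage, Measure.volume_eq_prod,
    Measure.prod_apply (measurable_finCons hA)]
  rfl

theorem volume_eq_lintegral_fiber_head {d : ℕ} {A : Set (Fin (d + 1) → ℝ)}
    (hA : MeasurableSet A) :
    volume A = ∫⁻ y : Fin d → ℝ, volume {t : ℝ | (Fin.cons t y : Fin (d + 1) → ℝ) ∈ A} := by
  rw [← volume_finCons_preimage, Measure.volume_eq_prod,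
    Measure.prod_apply_symm (measurable_finCons hA)]
  rfl

theorem volume_le_of_fiber_head {d : ℕ} {A B : Set (Fin (d + 1) → ℝ)}
    (hA : MeasurableSet A) (hB : MeasurableSet B) {K : ℝ≥0∞} (hK : K ≠ ∞)
    (h : ∀ y : Fin d → ℝ, volume {t : ℝ | (Fin.cons t y : Fin (d + 1) → ℝ) ∈ A} ≤
      K * volume {t : ℝ | (Fin.cons t y : Fin (d + 1) → ℝ) ∈ B}) :
    volume A ≤ K * volume B := by
  rw [volume_eq_lintegral_fiber_head hA, volume_eq_lintegral_fiber_head hB,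
    ← lintegral_const_mul' _ _ hK]
  exact lintegral_mono h

theorem volume_le_of_fiber_tail {d : ℕ} {A B : Set (Fin (d + 1) → ℝ)}
    (hA : MeasurableSet A) (hB : MeasurableSet B) {K : ℝ≥0∞} (hK : K ≠ ∞)
    (h : ∀ t : ℝ, volume {y : Fin d → ℝ | (Fin.cons t y : Fin (d + 1) → ℝ) ∈ A} ≤
      K * volume {y : Fin d → ℝ | (Fin.cons t y : Fin (d + 1) → ℝ) ∈ B}) :
    volume A ≤ K * volume B := by
  rw [volume_eq_lintegral_fiber_tail hA, volume_eq_lintegral_fiber_tail hB,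
    ← lintegral_const_mul' _ _ hK]
  exact lintegral_mono h

/-! ### Covering estimates for rectangles, by induction on the dimension. -/

namespace DyadicRect

instance {d : ℕ} : Countable (DyadicRect d) := inferInstanceAs (Countable (Fin d → DyadicInterval))

theorem measurableSet_toSet {d : ℕ} (R : DyadicRect d) : MeasurableSet R.toSet :=
  MeasurableSet.univ_pi fun i => (R i).measurableSet_toSet

theorem measurableSet_shadow {d : ℕ} (U : Set (DyadicRect d)) : MeasurableSet (shadow U) :=
  MeasurableSet.biUnion U.to_countable fun R _ => R.measurableSet_toSet

theorem volume_toSet {d : ℕ} (R : DyadicRect d) : volume R.toSet = ∏ i, volume (R i).toSet :=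
  volume_pi_pi _

theorem volume_toSet_ne_zero {d : ℕ} (R : DyadicRect d) : volume R.toSet ≠ 0 := by
  rw [volume_toSet]
  exact Finset.prod_ne_zero_iff.2 fun i _ => (R i).volume_toSet_ne_zero

theorem volume_toSet_ne_top {d : ℕ} (R : DyadicRect d) : volume R.toSet ≠ ∞ := by
  rw [volume_toSet]
  exact ENNReal.prod_ne_top fun i _ => (R i).volume_toSet_ne_top

theorem mem_shadow {d : ℕ} {U : Set (DyadicRect d)} {x : Fin d → ℝ} :
    x ∈ shadow U ↔ ∃ R ∈ U, x ∈ R.toSet := by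
  simp [shadow]

theorem shadow_mono {d : ℕ} {U W : Set (DyadicRect d)} (h : U ⊆ W) : shadow U ⊆ shadow W :=
  Set.biUnion_subset_biUnion_left h

theorem toSet_subset_shadow {d : ℕ} {U : Set (DyadicRect d)} {R : DyadicRect d} (h : R ∈ U) :
    R.toSet ⊆ shadow U :=
  Set.subset_biUnion_of_mem (u := toSet) h

/-- Enlarging the sides of every rectangle of a family monotonically and by a bounded factor
enlarges the shadow by a bounded factor. -/
theorem volume_biUnion_pi_le {K : ℝ≥0∞} (hK : K ≠ ∞) :
    ∀ {d : ℕ} {φ : Fin d → DyadicInterval → Set ℝ}, (∀ i, Monotone (φ i)) →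
      (∀ i I, MeasurableSet (φ i I)) → (∀ i I, volume (φ i I) ≤ K * volume I.toSet) →
      ∀ S : Set (DyadicRect d),
        volume (⋃ R ∈ S, Set.univ.pi fun i => φ i (R i)) ≤ K ^ d * volume (shadow S)
  | 0, φ, _, _, _, S => by
    rw [pow_zero, one_mul]
    refine measure_mono (Set.iUnion₂_mono fun R _ => ?_)
    intro x _ i
    exact i.elim0
  | d + 1, φ, hmono, hmeas, hvol, S => by
    set A : Set (Fin (d + 1) → ℝ) := ⋃ R ∈ S, Set.univ.pi fun i => φ i (R i) with hA
    -- Intermediate set: every side except the first is enlarged. A to M is one-dimensional on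
    -- fibers; M to the shadow is the induction hypothesis.
    set M : Set (Fin (d + 1) → ℝ) :=
      ⋃ R ∈ S, Set.univ.pi (Fin.cons (R 0).toSet fun i => φ i.succ (R i.succ)) with hM
    have hAm : MeasurableSet A :=
      MeasurableSet.biUnion S.to_countable fun R _ => MeasurableSet.univ_pi fun i => hmeas i _
    have hMm : MeasurableSet M :=
      MeasurableSet.biUnion S.to_countable fun R _ => MeasurableSet.univ_pi fun i =>
        Fin.cases (R 0).measurableSet_toSet (fun j => hmeas j.succ _) i
    have h1 : volume A ≤ K * volume M := by
      refine volume_le_of_fiber_head hAm hMm hK fun y => ?_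
      set T : Set DyadicInterval :=
        {J | ∃ R ∈ S, R 0 = J ∧ y ∈ Set.univ.pi fun i => φ i.succ (R i.succ)} with hT
      have e1 : {t : ℝ | (Fin.cons t y : Fin (d + 1) → ℝ) ∈ A} = ⋃ J ∈ T, φ 0 J := by
        ext t
        simp only [hA, hT, Set.mem_ofPred_eq, Set.mem_iUnion, exists_prop, Fin.cons_mem_univ_pi]
        constructor
        · rintro ⟨R, hR, h0, h1⟩
          exact ⟨R 0, ⟨R, hR, rfl, h1⟩, h0⟩
        · rintro ⟨_, ⟨R, hR, rfl, h1⟩, h0⟩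
          exact ⟨R, hR, h0, h1⟩
      have e2 : {t : ℝ | (Fin.cons t y : Fin (d + 1) → ℝ) ∈ M} = ⋃ J ∈ T, J.toSet := by
        ext t
        simp only [hM, hT, Set.mem_ofPred_eq, Set.mem_iUnion, exists_prop, Fin.cons_mem_univ_pi,
          Fin.cons_zero, Fin.cons_succ]
        constructor
        · rintro ⟨R, hR, h0, h1⟩
          exact ⟨R 0, ⟨R, hR, rfl, h1⟩, h0⟩
        · rintro ⟨_, ⟨R, hR, rfl, h1⟩, h0⟩
          exact ⟨R, hR, h0, h1⟩
      rw [e1, e2]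
      refine DyadicInterval.volume_biUnion_le (hmono 0)
        (MeasurableSet.biUnion T.to_countable fun J _ => J.measurableSet_toSet) fun J hJ => ?_
      rw [Set.inter_eq_left.2 (Set.subset_biUnion_of_mem (u := DyadicInterval.toSet) hJ)]
      exact hvol 0 J
    have h2 : volume M ≤ K ^ d * volume (shadow S) := by
      refine volume_le_of_fiber_tail hMm (measurableSet_shadow S) (ENNReal.pow_ne_top hK)
        fun t => ?_
      set T : Set (DyadicRect d) := {Q | ∃ R ∈ S, t ∈ (R 0).toSet ∧ Q = fun i => R i.succ} with hT
      have e1 : {y : Fin d → ℝ | (Fin.cons t y : Fin (d + 1) → ℝ) ∈ M} =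
          ⋃ Q ∈ T, Set.univ.pi fun i => φ i.succ (Q i) := by
        ext y
        simp only [hM, hT, Set.mem_ofPred_eq, Set.mem_iUnion, exists_prop, Fin.cons_mem_univ_pi,
          Fin.cons_zero, Fin.cons_succ]
        constructor
        · rintro ⟨R, hR, h0, h1⟩
          exact ⟨_, ⟨R, hR, h0, rfl⟩, h1⟩
        · rintro ⟨_, ⟨R, hR, h0, rfl⟩, h1⟩
          exact ⟨R, hR, h0, h1⟩
      have e2 : {y : Fin d → ℝ | (Fin.cons t y : Fin (d + 1) → ℝ) ∈ shadow S} = shadow T := by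
        ext y
        simp only [hT, Set.mem_ofPred_eq, mem_shadow, toSet, Fin.cons_mem_univ_pi]
        constructor
        · rintro ⟨R, hR, h0, h1⟩
          exact ⟨_, ⟨R, hR, h0, rfl⟩, h1⟩
        · rintro ⟨_, ⟨R, hR, h0, rfl⟩, h1⟩
          exact ⟨R, hR, h0, h1⟩
      rw [e1, e2]
      exact volume_biUnion_pi_le hK (fun i => hmono i.succ) (fun i => hmeas i.succ)
        (fun i => hvol i.succ) T
    calc volume A ≤ K * volume M := h1
      _ ≤ K * (K ^ d * volume (shadow S)) := by gcongr
      _ = K ^ (d + 1) * volume (shadow S) := by ring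

/-- The constant of the covering estimate `volume_shadow_le` in dimension `d`. -/
noncomputable def coverConst : ℕ → ℝ≥0∞ → ℝ≥0∞
  | 0, K => K
  | d + 1, K => coverConst d (2 * K) * (2 * K)

theorem coverConst_ne_top : ∀ (d : ℕ) {K : ℝ≥0∞}, K ≠ ∞ → coverConst d K ≠ ∞
  | 0, _, hK => hK
  | d + 1, _, hK =>
    have h := ENNReal.mul_ne_top ENNReal.ofNat_ne_top hK
    ENNReal.mul_ne_top (coverConst_ne_top d h) h

/-- If a fixed proportion of every rectangle of a family lies in `E`, then the shadow of the family
is at most a constant times as large as `E`. -/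
theorem volume_shadow_le : ∀ {d : ℕ} {K : ℝ≥0∞}, K ≠ ∞ → ∀ {E : Set (Fin d → ℝ)},
    MeasurableSet E → ∀ {S : Set (DyadicRect d)},
      (∀ P ∈ S, volume P.toSet ≤ K * volume (P.toSet ∩ E)) →
      volume (shadow S) ≤ coverConst d K * volume E
  | 0, K, _, E, _, S, h => by
    rcases S.eq_empty_or_nonempty with rfl | ⟨P, hP⟩
    · simp [shadow]
    · have hP' : P.toSet = Set.univ := Set.eq_univ_of_forall fun x i => i.elim0
      calc volume (shadow S) ≤ volume P.toSet := measure_mono (by simp [hP'])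
        _ ≤ K * volume (P.toSet ∩ E) := h P hP
        _ ≤ K * volume E := by gcongr; exact Set.inter_subset_right
  | d + 1, K, hK, E, hE, S, h => by
    have hK2 : 2 * K ≠ ∞ := ENNReal.mul_ne_top ENNReal.ofNat_ne_top hK
    have hpre : MeasurableSet
        ((fun p : ℝ × (Fin d → ℝ) => (Fin.cons p.1 p.2 : Fin (d + 1) → ℝ)) ⁻¹' E) :=
      measurable_finCons hE
    set f : DyadicInterval → (Fin d → ℝ) → ℝ≥0∞ := fun J y =>
      volume (J.toSet ∩ {t : ℝ | (Fin.cons t y : Fin (d + 1) → ℝ) ∈ E}) with hf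
    have hfm : ∀ J, Measurable (f J) := fun J => by
      have hJ : f J = fun y => volume ((fun t => (t, y)) ⁻¹' (J.toSet ×ˢ Set.univ ∩
          (fun p : ℝ × (Fin d → ℝ) => (Fin.cons p.1 p.2 : Fin (d + 1) → ℝ)) ⁻¹' E)) := by
        funext y
        simp only [hf]
        congr 1
        ext t
        simp
      rw [hJ]
      exact measurable_measure_prodMk_right
        ((J.measurableSet_toSet.prod MeasurableSet.univ).inter hpre)
    -- Points whose line in direction 0 contains a dyadic interval around them filled by E to
    -- proportion at least 1/(2K).
    set E₁ : Set (Fin (d + 1) → ℝ) :=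
      {x | ∃ J : DyadicInterval, x 0 ∈ J.toSet ∧ volume J.toSet ≤ 2 * K * f J fun i => x i.succ}
      with hE₁
    have hE₁m : MeasurableSet E₁ := by
      have : E₁ = ⋃ J : DyadicInterval, {x | x 0 ∈ J.toSet} ∩
          {x | volume J.toSet ≤ 2 * K * f J fun i => x i.succ} := by
        ext x
        simp [hE₁]
      rw [this]
      refine MeasurableSet.iUnion fun J => MeasurableSet.inter
        (measurable_pi_apply 0 J.measurableSet_toSet) (measurableSet_le measurable_const ?_)
      exact ((hfm J).comp (measurable_pi_iff.2 fun i => measurable_pi_apply i.succ)).const_mul _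
    have h1 : volume E₁ ≤ 2 * K * volume E := by
      refine volume_le_of_fiber_head hE₁m hE hK2 fun y => ?_
      have e1 : {t : ℝ | (Fin.cons t y : Fin (d + 1) → ℝ) ∈ E₁} =
          ⋃ J ∈ {J : DyadicInterval | volume J.toSet ≤ 2 * K * f J y}, J.toSet := by
        ext t
        simp [hE₁, and_comm]
      rw [e1]
      refine DyadicInterval.volume_biUnion_le (fun _ _ h => h) ?_ fun J hJ => hJ
      exact measurable_prodMk_right hpre
    have h2 : volume (shadow S) ≤ coverConst d (2 * K) * volume E₁ := by
      refine volume_le_of_fiber_tail (measurableSet_shadow S) hE₁m (coverConst_ne_top d hK2)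
        fun t => ?_
      set T : Set (DyadicRect d) := {Q | ∃ R ∈ S, t ∈ (R 0).toSet ∧ Q = fun i => R i.succ} with hT
      have e1 : {y : Fin d → ℝ | (Fin.cons t y : Fin (d + 1) → ℝ) ∈ shadow S} = shadow T := by
        ext y
        simp only [hT, Set.mem_ofPred_eq, mem_shadow, toSet, Fin.cons_mem_univ_pi]
        constructor
        · rintro ⟨R, hR, h0, h1⟩
          exact ⟨_, ⟨R, hR, h0, rfl⟩, h1⟩
        · rintro ⟨_, ⟨R, hR, h0, rfl⟩, h1⟩
          exact ⟨R, hR, h0, h1⟩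
      rw [e1]
      refine volume_shadow_le hK2 (measurable_finCons.comp measurable_prodMk_left hE₁m) ?_
      rintro _ ⟨R, hR, ht, rfl⟩
      set J := R 0
      set Q : DyadicRect d := fun i => R i.succ with hQ
      set G : Set (Fin d → ℝ) := {y | volume J.toSet ≤ 2 * K * f J y} with hG
      have hGm : MeasurableSet G := measurableSet_le measurable_const ((hfm J).const_mul _)
      have hRvol : volume R.toSet = volume J.toSet * volume Q.toSet := by
        rw [volume_toSet, volume_toSet, Fin.prod_univ_succ]
      have hint : volume (R.toSet ∩ E) = ∫⁻ y in Q.toSet, f J y := by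
        rw [volume_eq_lintegral_fiber_head (R.measurableSet_toSet.inter hE),
          ← lintegral_indicator Q.measurableSet_toSet]
        refine lintegral_congr fun y => ?_
        by_cases hy : y ∈ Q.toSet
        · rw [Set.indicator_of_mem hy, hf]
          congr 1
          ext t
          have : y ∈ Set.univ.pi fun i => (R i.succ).toSet := hy
          simp only [Set.mem_ofPred_eq, Set.mem_inter_iff, toSet, Fin.cons_mem_univ_pi, this,
            and_true, J]
        · rw [Set.indicator_of_notMem hy]
          convert measure_empty (μ := volume)
          refine Set.eq_empty_of_forall_notMem fun t ht => hy ?_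
          exact (Fin.cons_mem_univ_pi.1 ht.1).2
      -- Chebyshev argument: slices outside G contribute at most |J| each, so after integration over
      -- Q they account for at most |R| of the total 2|R|; the slices in G must supply the rest.
      have hpt : ∀ y, 2 * K * f J y ≤
          G.indicator (fun _ => 2 * K * volume J.toSet) y + volume J.toSet := by
        intro y
        by_cases hy : y ∈ G
        · rw [Set.indicator_of_mem hy]
          refine le_add_right ?_
          gcongr
          exact measure_mono Set.inter_subset_left
        · rw [Set.indicator_of_notMem hy, zero_add]
          exact (not_le.1 hy).le
      have key : volume R.toSet + volume R.toSet ≤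
          2 * K * volume J.toSet * volume (Q.toSet ∩ G) + volume R.toSet := by
        calc volume R.toSet + volume R.toSet = 2 * volume R.toSet := (two_mul _).symm
          _ ≤ 2 * (K * volume (R.toSet ∩ E)) := by gcongr; exact h R hR
          _ = ∫⁻ y in Q.toSet, 2 * K * f J y := by
              rw [hint, lintegral_const_mul' _ _ hK2, mul_assoc]
          _ ≤ ∫⁻ y in Q.toSet,
                (G.indicator (fun _ => 2 * K * volume J.toSet) y + volume J.toSet) :=
              lintegral_mono hpt
          _ = 2 * K * volume J.toSet * volume (Q.toSet ∩ G) + volume R.toSet := by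
              rw [lintegral_add_right _ measurable_const, lintegral_indicator_const hGm,
                setLIntegral_const, Measure.restrict_apply hGm, Set.inter_comm G, hRvol]
      have key' := ENNReal.le_of_add_le_add_right R.volume_toSet_ne_top key
      rw [hRvol] at key'
      have key'' : volume Q.toSet ≤ 2 * K * volume (Q.toSet ∩ G) := by
        rw [← ENNReal.mul_le_mul_iff_right J.volume_toSet_ne_zero J.volume_toSet_ne_top]
        refine key'.trans (le_of_eq ?_)
        ring
      refine key''.trans ?_
      gcongr
      intro y hy
      exact ⟨J, by simpa using ht, by simpa [hG] using hy⟩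
    calc volume (shadow S) ≤ coverConst d (2 * K) * volume E₁ := h2
      _ ≤ coverConst d (2 * K) * (2 * K * volume E) := by gcongr
      _ = coverConst (d + 1) K * volume E := by rw [coverConst]; ring

end DyadicRect

/-! ### Bounded overlap between families with different j-th sides. -/

theorem volume_setOf_mem_and_succAbove_mem {d : ℕ} (j : Fin (d + 1)) (J : Set ℝ)
    (B : Set (Fin d → ℝ)) :
    volume {x : Fin (d + 1) → ℝ | x j ∈ J ∧ (fun i => x (j.succAbove i)) ∈ B} =
      volume J * volume B := by
  have h := (volume_preserving_piFinSuccAbove (fun _ : Fin (d + 1) => ℝ) j).measure_preimage_equiv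
    (J ×ˢ B)
  rw [Measure.volume_eq_prod, Measure.prod_prod] at h
  rw [← h]
  rfl

namespace DyadicRect

theorem mem_toSet_update {d : ℕ} {P : DyadicRect (d + 1)} {j : Fin (d + 1)} {J : DyadicInterval}
    {x : Fin (d + 1) → ℝ} :
    x ∈ toSet (Function.update P j J) ↔
      x j ∈ J.toSet ∧ (fun i => x (j.succAbove i)) ∈ toSet fun i => P (j.succAbove i) := by
  simp [toSet, Set.mem_pi, Fin.forall_iff_succAbove j]

theorem volume_toSet_update {d : ℕ} (P : DyadicRect (d + 1)) (j : Fin (d + 1))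
    (J : DyadicInterval) :
    volume (toSet (Function.update P j J)) =
      volume J.toSet * volume (toSet fun i => P (j.succAbove i)) := by
  rw [← volume_setOf_mem_and_succAbove_mem j]
  congr 1
  ext x
  exact mem_toSet_update

/-- Over J the j-th constraint of every Q is automatic, so the intersection is a product and its
density does not depend on J. This transfers density from an enlarged rectangle back to the
original. -/
theorem volume_toSet_update_inter_shadow {d : ℕ} (P : DyadicRect (d + 1)) (j : Fin (d + 1))
    {J : DyadicInterval} {X : Set (DyadicRect (d + 1))} (hX : ∀ Q ∈ X, J ≤ Q j) :
    volume (toSet (Function.update P j J) ∩ shadow X) =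
      volume J.toSet * volume ((toSet fun i => P (j.succAbove i)) ∩
        ⋃ Q ∈ X, toSet fun i => Q (j.succAbove i)) := by
  rw [← volume_setOf_mem_and_succAbove_mem j]
  congr 1
  ext x
  simp only [Set.mem_inter_iff, mem_toSet_update, mem_shadow, Set.mem_ofPred_eq, Set.mem_iUnion,
    exists_prop, and_assoc]
  refine and_congr_right fun hx => and_congr_right fun _ => exists_congr fun Q =>
    and_congr_right fun hQ => ?_
  have := mem_toSet_update (P := Q) (j := j) (J := Q j) (x := x)
  rw [Function.update_eq_self] at this
  rw [this]
  exact and_iff_right (hX Q hQ hx)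

/-- If every rectangle `P` of a family lies in `O`, but its `v`-fold dyadic enlargement in the `j`-th
coordinate does not have half of its measure in `O`, then the parts of the shadow that belong to the
different `j`-th sides have overlap of order `v`. -/
theorem tsum_volume_shadow_le {d : ℕ} (j : Fin d) (v : ℕ) {O : Set (Fin d → ℝ)}
    {S : Set (DyadicRect d)} (hO : ∀ P ∈ S, P.toSet ⊆ O)
    (h : ∀ P ∈ S, 2 * volume (toSet (Function.update P j ((P j).ancestor v)) ∩ O) <
      volume (toSet (Function.update P j ((P j).ancestor v)))) :
    ∑' I : DyadicInterval, volume (shadow {P | P ∈ S ∧ P j = I}) ≤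
      coverConst d 2 * (v * volume (shadow S)) := by
  obtain _ | d := d
  · exact j.elim0
  set X : DyadicInterval → Set (DyadicRect (d + 1)) :=
    fun I => {P | P ∈ S ∧ I.ancestor v ≤ P j} with hX
  -- The part of the I-shadow missed by rectangles whose j-th side is at least v generations above
  -- I.
  set A : DyadicInterval → Set (Fin (d + 1) → ℝ) :=
    fun I => shadow {P | P ∈ S ∧ P j = I} \ shadow (X I) with hA
  have hAm : ∀ I, MeasurableSet (A I) := fun I =>
    (measurableSet_shadow _).diff (measurableSet_shadow _)
  have hcover : ∀ I, volume (shadow {P | P ∈ S ∧ P j = I}) ≤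
      coverConst (d + 1) 2 * volume (A I) := by
    intro I
    refine volume_shadow_le ENNReal.ofNat_ne_top (hAm I) ?_
    rintro P ⟨hP, rfl⟩
    have h1 : 2 * volume (toSet (Function.update P j ((P j).ancestor v)) ∩ shadow (X (P j))) <
        volume (toSet (Function.update P j ((P j).ancestor v))) := by
      refine lt_of_le_of_lt ?_ (h P hP)
      gcongr
      exact Set.iUnion₂_subset fun Q hQ => hO Q hQ.1
    rw [volume_toSet_update_inter_shadow P j fun Q hQ => hQ.2, volume_toSet_update,
      mul_left_comm] at h1
    have h2 := lt_of_mul_lt_mul_left' h1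
    have h3 := volume_toSet_update_inter_shadow P j (J := P j) (X := X (P j))
      fun Q hQ => (DyadicInterval.le_ancestor v _).trans hQ.2
    have h4 := volume_toSet_update P j (P j)
    rw [Function.update_eq_self] at h3 h4
    have h5 : 2 * volume (P.toSet ∩ shadow (X (P j))) ≤ volume P.toSet := by
      rw [h3, h4, mul_left_comm]
      gcongr
    have h6 : P.toSet ∩ A (P j) = P.toSet \ shadow (X (P j)) := by
      rw [hA, ← Set.inter_sdiff_assoc, Set.inter_eq_left.2]
      exact toSet_subset_shadow ⟨hP, rfl⟩
    have h7 : volume P.toSet + volume P.toSet ≤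
        volume P.toSet + 2 * volume (P.toSet \ shadow (X (P j))) := by
      calc volume P.toSet + volume P.toSet = 2 * volume P.toSet := (two_mul _).symm
        _ = 2 * volume (P.toSet ∩ shadow (X (P j))) +
              2 * volume (P.toSet \ shadow (X (P j))) := by
            rw [← mul_add, measure_inter_add_sdiff _ (measurableSet_shadow _)]
        _ ≤ _ := by gcongr
    rw [h6]
    exact ENNReal.le_of_add_le_add_left P.volume_toSet_ne_top h7
  have hoverlap : ∀ x, ∑' I, (A I).indicator (1 : (Fin (d + 1) → ℝ) → ℝ≥0∞) x ≤
      (shadow S).indicator (fun _ => (v : ℝ≥0∞)) x := by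
    classical
    intro x
    by_cases hx : x ∈ shadow S
    · rw [Set.indicator_of_mem hx, ENNReal.tsum_eq_iSup_sum]
      refine iSup_le fun s => ?_
      set t := s.filter (fun I => x ∈ A I) with ht
      have hsum : ∑ I ∈ s, (A I).indicator (1 : (Fin (d + 1) → ℝ) → ℝ≥0∞) x = (t.card : ℝ≥0∞) := by
        simp only [Set.indicator_apply, Pi.one_apply]
        rw [ht, Finset.sum_boole]
      rw [hsum]
      have hmem : ∀ I ∈ t, x j ∈ I.toSet := by
        intro I hI
        obtain ⟨P, ⟨-, rfl⟩, hP⟩ := mem_shadow.1 (Finset.mem_filter.1 hI).2.1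
        exact hP j trivial
      have hlt : ∀ I ∈ t, ∀ J ∈ t, J.scale < I.scale + v := by
        intro I hI J hJ
        by_contra! hle
        refine (Finset.mem_filter.1 hI).2.2 ?_
        obtain ⟨P, ⟨hPS, rfl⟩, hP⟩ := mem_shadow.1 (Finset.mem_filter.1 hJ).2.1
        exact mem_shadow.2 ⟨P, ⟨hPS, DyadicInterval.le_of_mem_of_scale_le
          (DyadicInterval.le_ancestor v I (hmem I hI)) (hmem _ hJ) hle⟩, hP⟩
      rcases t.eq_empty_or_nonempty with he | hne
      · simp [he]
      obtain ⟨I₀, hI₀, hmin⟩ := t.exists_min_image (fun I => I.scale) hne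
      -- The intervals in t all contain x j, so they are determined by their scales, which lie in a
      -- window of v integers.
      have hcard : t.card ≤ (Finset.Ico I₀.scale (I₀.scale + v)).card := by
        refine Finset.card_le_card_of_injOn (fun I => I.scale) ?_ ?_
        · intro I hI
          exact Finset.mem_coe.2 (Finset.mem_Ico.2 ⟨hmin I hI, hlt I₀ hI₀ I hI⟩)
        · intro I hI J hJ hIJ
          exact DyadicInterval.eq_of_mem_of_scale_eq (hmem I hI) (hmem J hJ) hIJ
      simp only [Int.card_Ico, add_sub_cancel_left, Int.toNat_natCast] at hcard
      exact_mod_cast hcard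
    · rw [Set.indicator_of_notMem hx]
      refine le_of_eq (ENNReal.tsum_eq_zero.2 fun I => Set.indicator_of_notMem (fun hxA => hx ?_) _)
      exact shadow_mono (fun P hP => hP.1) hxA.1
  calc ∑' I : DyadicInterval, volume (shadow {P | P ∈ S ∧ P j = I})
      ≤ ∑' I, coverConst (d + 1) 2 * volume (A I) := ENNReal.tsum_le_tsum hcover
    _ = coverConst (d + 1) 2 * ∑' I, volume (A I) := ENNReal.tsum_mul_left
    _ ≤ coverConst (d + 1) 2 * (v * volume (shadow S)) := by
        gcongr
        calc ∑' I, volume (A I)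
            = ∑' I, ∫⁻ x, (A I).indicator 1 x := by
              simp only [lintegral_indicator_one (hAm _)]
          _ = ∫⁻ x, ∑' I, (A I).indicator 1 x :=
              (lintegral_tsum fun I => (measurable_one.indicator (hAm I)).aemeasurable).symm
          _ ≤ ∫⁻ x, (shadow S).indicator (fun _ => (v : ℝ≥0∞)) x := lintegral_mono hoverlap
          _ = v * volume (shadow S) := lintegral_indicator_const (measurableSet_shadow S) _

end DyadicRect

/-! ### Enlargements, raised rectangles and the stopping time. -/

namespace DyadicRect

/-- The iterated enlargements of the shadow of `U`: each one is the union of the dyadic rectangles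
with at least half of their measure in the previous one. -/
noncomputable def enlargement {d : ℕ} (U : Set (DyadicRect d)) : ℕ → Set (Fin d → ℝ)
  | 0 => shadow U
  | n + 1 => shadow {P | volume P.toSet ≤ 2 * volume (P.toSet ∩ enlargement U n)}

theorem measurableSet_enlargement {d : ℕ} (U : Set (DyadicRect d)) :
    ∀ n, MeasurableSet (enlargement U n)
  | 0 => measurableSet_shadow _
  | _ + 1 => measurableSet_shadow _

theorem volume_enlargement_le {d : ℕ} (U : Set (DyadicRect d)) (n : ℕ) :
    volume (enlargement U n) ≤ coverConst d 2 ^ n * volume (shadow U) := by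
  induction n with
  | zero => simp [enlargement]
  | succ n ih =>
    calc volume (enlargement U (n + 1))
        ≤ coverConst d 2 * volume (enlargement U n) :=
          volume_shadow_le ENNReal.ofNat_ne_top (measurableSet_enlargement U n) fun P hP => hP
      _ ≤ coverConst d 2 * (coverConst d 2 ^ n * volume (shadow U)) := by gcongr
      _ = coverConst d 2 ^ (n + 1) * volume (shadow U) := by ring

theorem toSet_subset_enlargement {d : ℕ} {U : Set (DyadicRect d)} {R : DyadicRect d} (hR : R ∈ U) :
    ∀ n, R.toSet ⊆ enlargement U n
  | 0 => toSet_subset_shadow hR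
  | n + 1 => by
    refine toSet_subset_shadow ?_
    rw [Set.mem_ofPred_eq, Set.inter_eq_left.2 (toSet_subset_enlargement hR n)]
    exact le_mul_of_one_le_left' one_le_two

/-- The rectangle whose first `n` sides are the `v`-fold dyadic ancestors of those of `R`, and whose
other sides are those of `R`. -/
def raise {d : ℕ} (v n : ℕ) (R : DyadicRect d) : DyadicRect d :=
  fun i => if i.val < n then (R i).ancestor v else R i

/-- Only coordinates before j are raised, so grouping rectangles by their j-th side survives the
raise. -/
theorem raise_apply_self {d : ℕ} (v : ℕ) (R : DyadicRect d) (j : Fin d) : R.raise v j j = R j := by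
  simp [raise]

theorem raise_zero {d : ℕ} (v : ℕ) (R : DyadicRect d) : R.raise v 0 = R := by
  funext i
  simp [raise]

theorem raise_of_eq_zero {d : ℕ} (n : ℕ) (R : DyadicRect d) : R.raise 0 n = R := by
  funext i
  simp [raise, DyadicInterval.ancestor]

theorem raise_self_apply {d : ℕ} (v : ℕ) (R : DyadicRect d) (i : Fin d) :
    R.raise v d i = (R i).ancestor v := by
  simp [raise]

theorem raise_succ {d : ℕ} (v : ℕ) (R : DyadicRect d) (j : Fin d) :
    R.raise v (j + 1) =
      Function.update (R.raise v j) j ((R.raise v j j).ancestor v) := by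
  funext i
  rcases eq_or_ne i j with rfl | hij
  · simp [raise]
  · have : i.val ≠ j.val := fun h => hij (Fin.ext h)
    have h : i.val < j + 1 ↔ i.val < j := by omega
    simp [raise, hij, h]

theorem toSet_subset_toSet_raise {d : ℕ} (v n : ℕ) (R : DyadicRect d) :
    R.toSet ⊆ (R.raise v n).toSet := by
  refine Set.pi_mono fun i _ => ?_
  unfold raise
  split_ifs
  · exact DyadicInterval.le_ancestor v (R i)
  · exact subset_rfl

theorem volume_shadow_image_raise_le {d : ℕ} (v n : ℕ) (W : Set (DyadicRect d)) :
    volume (shadow (raise v n '' W)) ≤ (2 ^ v) ^ d * volume (shadow W) := by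
  have h : shadow (raise v n '' W) = ⋃ R ∈ W, Set.univ.pi fun i : Fin d =>
      (fun I : DyadicInterval => if i.val < n then (I.ancestor v).toSet else I.toSet) (R i) := by
    rw [shadow, Set.biUnion_image]
    refine Set.iUnion₂_congr fun R _ => ?_
    unfold toSet raise
    congr 1
    funext i
    split_ifs <;> rfl
  rw [h]
  refine volume_biUnion_pi_le (ENNReal.pow_ne_top ENNReal.ofNat_ne_top)
    (φ := fun i : Fin d => fun I : DyadicInterval =>
      if i.val < n then (I.ancestor v).toSet else I.toSet) ?_ ?_ ?_ W
  · intro i I J hIJ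
    dsimp only
    split_ifs
    · exact DyadicInterval.ancestor_mono v hIJ
    · exact hIJ
  · intro i I
    split_ifs
    · exact DyadicInterval.measurableSet_toSet _
    · exact DyadicInterval.measurableSet_toSet _
  · intro i I
    dsimp only
    split_ifs
    · exact (DyadicInterval.volume_ancestor v I).le
    · exact le_mul_of_one_le_left' (one_le_pow₀ one_le_two)

/-- The raised rectangle has measure 2^{vd}|R|, unbounded in v because d ≥ 1. -/
theorem exists_raise_not_subset {d : ℕ} (hd : 1 ≤ d) (R : DyadicRect d) {O : Set (Fin d → ℝ)}
    (hO : volume O ≠ ∞) : ∃ v, ¬ (R.raise v d).toSet ⊆ O := by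
  obtain ⟨v, hv⟩ := ENNReal.exists_nat_mul_gt R.volume_toSet_ne_zero hO
  refine ⟨v, fun hsub => ?_⟩
  refine (hv.trans_le ?_).not_ge (measure_mono hsub)
  simp only [volume_toSet, raise_self_apply, DyadicInterval.volume_ancestor]
  rw [Finset.prod_mul_distrib, Finset.prod_const, Finset.card_univ, Fintype.card_fin]
  gcongr
  calc (v : ℝ≥0∞) ≤ ((2 ^ v : ℕ) : ℝ≥0∞) := by exact_mod_cast Nat.lt_two_pow_self.le
    _ = 2 ^ v := by push_cast; rfl
    _ ≤ (2 ^ v) ^ d := le_self_pow₀ (one_le_pow₀ one_le_two) (by omega)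

/-- Each rectangle of `U` has a largest number `N` of generations through which it can be raised
inside the enlargements, and a coordinate in which the next raise fails. -/
theorem exists_raise_stop {d : ℕ} (hd : 1 ≤ d) {U : Set (DyadicRect d)}
    (hU : volume (shadow U) < ∞) {R : DyadicRect d} (hR : R ∈ U) :
    ∃ (N : ℕ) (j : Fin d), (R.raise N d).toSet ⊆ enlargement U d ∧
      (R.raise (N + 1) j).toSet ⊆ enlargement U j ∧
      ¬ (R.raise (N + 1) (j + 1)).toSet ⊆ enlargement U (j + 1) := by
  classical
  have hfin : volume (enlargement U d) ≠ ∞ :=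
    ne_top_of_le_ne_top (ENNReal.mul_ne_top
      (ENNReal.pow_ne_top (coverConst_ne_top d ENNReal.ofNat_ne_top)) hU.ne)
      (volume_enlargement_le U d)
  have hex : ∃ v, ∃ n, n ≤ d ∧ ¬ (R.raise v n).toSet ⊆ enlargement U n := by
    obtain ⟨v, hv⟩ := exists_raise_not_subset hd R hfin
    exact ⟨v, d, le_rfl, hv⟩
  have hpos : Nat.find hex ≠ 0 := by
    intro h0
    obtain ⟨n, -, hn⟩ := Nat.find_spec hex
    rw [h0, raise_of_eq_zero] at hn
    exact hn (toSet_subset_enlargement hR n)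
  obtain ⟨N, hN⟩ := Nat.exists_eq_succ_of_ne_zero hpos
  have hgood : ∀ n ≤ d, (R.raise N n).toSet ⊆ enlargement U n := by
    intro n hn
    by_contra hcon
    exact Nat.find_min hex (m := N) (by omega) ⟨n, hn, hcon⟩
  have hbad : ∃ n, n ≤ d ∧ ¬ (R.raise (N + 1) n).toSet ⊆ enlargement U n := by
    have := Nat.find_spec hex
    rwa [hN] at this
  -- The first failing n is positive, as raising no side gives R itself, inside the shadow; its
  -- predecessor is the coordinate j.
  have hpos' : Nat.find hbad ≠ 0 := by
    intro h0
    have h := (Nat.find_spec hbad).2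
    rw [h0, raise_zero] at h
    exact h (toSet_subset_enlargement hR 0)
  obtain ⟨j, hj⟩ := Nat.exists_eq_succ_of_ne_zero hpos'
  have hspec := Nat.find_spec hbad
  rw [hj] at hspec
  refine ⟨N, ⟨j, by omega⟩, hgood d le_rfl, ?_, hspec.2⟩
  by_contra hcon
  exact Nat.find_min hbad (m := j) (by omega) ⟨by omega, hcon⟩

theorem volume_biUnion_dilate_three_le {d : ℕ} (S : Set (DyadicRect d)) :
    volume (⋃ P ∈ S, dilate 3 P) ≤ 3 ^ d * volume (shadow S) := by
  refine volume_biUnion_pi_le ENNReal.ofNat_ne_top (φ := fun _ => DyadicInterval.dilate 3)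
    (fun _ _ _ h => DyadicInterval.dilate_three_mono h)
    (fun _ I => I.measurableSet_dilate 3) (fun _ I => ?_) S
  rw [DyadicInterval.volume_dilate, DyadicInterval.volume_toSet, ENNReal.ofReal_mul (by norm_num),
    ENNReal.ofReal_ofNat]

theorem dilate_subset_dilate_raise {d : ℕ} (N : ℕ) (R : DyadicRect d) :
    R.dilate (2 ^ N) ⊆ (R.raise N d).dilate 3 := by
  refine Set.pi_mono fun i _ => ?_
  rw [raise_self_apply]
  exact DyadicInterval.dilate_subset_dilate_ancestor N (R i)

theorem tsum_volume_shadow_side_le {d : ℕ} {U W : Set (DyadicRect d)} (j : Fin d) (v : ℕ)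
    (h : ∀ R ∈ W, (R.raise v j).toSet ⊆ enlargement U j ∧
      ¬ (R.raise v (j + 1)).toSet ⊆ enlargement U (j + 1)) :
    ∑' I : DyadicInterval, volume (shadow {R | R ∈ W ∧ R j = I}) ≤
      coverConst d 2 * (v * ((2 ^ v) ^ d * volume (shadow W))) := by
  calc ∑' I : DyadicInterval, volume (shadow {R | R ∈ W ∧ R j = I})
      ≤ ∑' I : DyadicInterval, volume (shadow {P | P ∈ raise v j '' W ∧ P j = I}) := by
        refine ENNReal.tsum_le_tsum fun I => measure_mono ?_
        refine Set.iUnion₂_subset fun R hR => (toSet_subset_toSet_raise v j R).trans ?_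
        exact toSet_subset_shadow
          ⟨Set.mem_image_of_mem _ hR.1, (raise_apply_self v R j).trans hR.2⟩
    _ ≤ coverConst d 2 * (v * volume (shadow (raise v j '' W))) := by
        refine tsum_volume_shadow_le j v (O := enlargement U j) ?_ ?_
        · rintro _ ⟨R, hR, rfl⟩
          exact (h R hR).1
        · rintro _ ⟨R, hR, rfl⟩
          -- If the further raise were half filled by `enlargement U j`, it would belong to the
          -- family defining the next enlargement, contrary to the stopping rule.
          rw [← raise_succ]
          by_contra! hle
          exact (h R hR).2 (toSet_subset_shadow hle)
    _ ≤ _ := by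
        gcongr
        exact volume_shadow_image_raise_le v j W

/-- The factor 2^{-dv} cancels the volume growth, leaving 2^d Σ (v+1) 2^{-εv}. -/
theorem tsum_weight_ne_top (d : ℕ) {ε : ℝ} (hε : 0 < ε) :
    ∑' v : ℕ, ENNReal.ofReal ((2 : ℝ) ^ (-((d : ℝ) + ε) * (v : ℝ))) *
      (((v + 1 : ℕ) : ℝ≥0∞) * (2 ^ (v + 1)) ^ d) ≠ ∞ := by
  set r : ℝ := (2 : ℝ) ^ (-ε) with hr
  have hr0 : 0 < r := by positivity
  have hr1 : r < 1 := Real.rpow_lt_one_of_one_lt_of_neg (by norm_num) (by linarith)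
  have hterm : ∀ v : ℕ, ENNReal.ofReal ((2 : ℝ) ^ (-((d : ℝ) + ε) * (v : ℝ))) *
      (((v + 1 : ℕ) : ℝ≥0∞) * (2 ^ (v + 1)) ^ d) =
      ENNReal.ofReal (2 ^ d * ((v : ℝ) ^ 1 * r ^ v + r ^ v)) := by
    intro v
    have h1 : (((v + 1 : ℕ) : ℝ≥0∞) * (2 ^ (v + 1)) ^ d) =
        ENNReal.ofReal (((v : ℝ) + 1) * (2 ^ (v + 1)) ^ d) := by
      rw [ENNReal.ofReal_mul (by positivity), ENNReal.ofReal_pow (by positivity),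
        ENNReal.ofReal_pow (by norm_num), ENNReal.ofReal_ofNat, ← Nat.cast_succ,
        ENNReal.ofReal_natCast]
    have h2 : (2 : ℝ) ^ (-((d : ℝ) + ε) * (v : ℝ)) = ((2 ^ v) ^ d)⁻¹ * r ^ v := by
      rw [neg_add, add_mul, Real.rpow_add (by norm_num), hr, ← Real.rpow_mul_natCast (by norm_num),
        neg_mul, Real.rpow_neg (by norm_num), ← Nat.cast_mul, Real.rpow_natCast, mul_comm d v,
        pow_mul]
    rw [h1, ← ENNReal.ofReal_mul (by positivity), h2]
    congr 1
    have : ((2 : ℝ) ^ v) ^ d ≠ 0 := by positivity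
    rw [pow_succ, mul_pow]
    field_simp
  simp only [hterm]
  refine Summable.tsum_ofReal_ne_top (Summable.mul_left _ (Summable.add ?_ ?_))
  · exact summable_pow_mul_geometric_of_norm_lt_one 1 (by rwa [Real.norm_of_nonneg hr0.le])
  · exact summable_geometric_of_lt_one hr0.le hr1

end DyadicRect

/-! ### Assembly. -/

theorem lemmal (d : ℕ) (hd : 1 ≤ d) (ε : ℝ) (hε : 0 < ε) :
    ∃ C : ℝ≥0, ∀ U : Set (DyadicRect d), volume (DyadicRect.shadow U) < ∞ →
      ∃ (V : Set (Fin d → ℝ)) (emb : DyadicRect d → ℝ) (sel : DyadicRect d → Fin d),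
        MeasurableSet V ∧
        DyadicRect.shadow U ⊆ V ∧
        volume V ≤ (C : ℝ≥0∞) * volume (DyadicRect.shadow U) ∧
        (∀ R ∈ U, 1 ≤ emb R ∧ DyadicRect.dilate (emb R) R ⊆ V) ∧
        ∀ U' : Set (DyadicRect d), U' ⊆ U →
          (∑ j : Fin d, ∑' v : ℕ, ∑' I : DyadicInterval,
            ENNReal.ofReal ((2 : ℝ) ^ (-((d : ℝ) + ε) * (v : ℝ))) *
              volume (DyadicRect.levelUnion emb sel I j v U')) ≤
            (C : ℝ≥0∞) * volume (DyadicRect.shadow U') := by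
  classical
  set c := DyadicRect.coverConst d 2
  have hc : c ≠ ∞ := DyadicRect.coverConst_ne_top d ENNReal.ofNat_ne_top
  set w : ℕ → ℝ≥0∞ := fun v => ENNReal.ofReal ((2 : ℝ) ^ (-((d : ℝ) + ε) * (v : ℝ))) with hw
  set s : ℕ → ℝ≥0∞ := fun v => ((v + 1 : ℕ) : ℝ≥0∞) * (2 ^ (v + 1)) ^ d with hs
  set σ : ℝ≥0∞ := ∑' v, w v * s v
  have hσ : σ ≠ ∞ := DyadicRect.tsum_weight_ne_top d hε
  have h1 : (3 : ℝ≥0∞) ^ d * c ^ d ≠ ∞ :=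
    ENNReal.mul_ne_top (ENNReal.pow_ne_top ENNReal.ofNat_ne_top) (ENNReal.pow_ne_top hc)
  have h2 : (d : ℝ≥0∞) * (c * σ) ≠ ∞ :=
    ENNReal.mul_ne_top (ENNReal.natCast_ne_top d) (ENNReal.mul_ne_top hc hσ)
  -- The first summand bounds |V|: tripling, then d enlargements. The second bounds the weighted sum
  -- over the d coordinates.
  refine ⟨(3 ^ d * c ^ d + d * (c * σ)).toNNReal, fun U hU => ?_⟩
  rw [ENNReal.coe_toNNReal (ENNReal.add_ne_top.2 ⟨h1, h2⟩)]
  have : Nonempty (Fin d) := ⟨⟨0, hd⟩⟩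
  choose! N sel hstay hin hout using
    fun (R : DyadicRect d) (hR : R ∈ U) => DyadicRect.exists_raise_stop hd hU hR
  set S : Set (DyadicRect d) := {P | P.toSet ⊆ DyadicRect.enlargement U d} with hS
  have hV : ∀ R ∈ U, R.dilate (2 ^ N R) ⊆ ⋃ P ∈ S, P.dilate 3 := fun R hR =>
    (DyadicRect.dilate_subset_dilate_raise (N R) R).trans
      (Set.subset_biUnion_of_mem (u := DyadicRect.dilate 3) (hstay R hR))
  have hone : ∀ R : DyadicRect d, (1 : ℝ) ≤ 2 ^ N R := fun R => one_le_pow₀ one_le_two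
  refine ⟨⋃ P ∈ S, P.dilate 3, fun R => 2 ^ N R, sel, ?_, ?_, ?_,
    fun R hR => ⟨hone R, hV R hR⟩, ?_⟩
  · exact MeasurableSet.biUnion S.to_countable fun P _ =>
      MeasurableSet.univ_pi fun i => (P i).measurableSet_dilate 3
  · refine Set.iUnion₂_subset fun R hR => Set.Subset.trans ?_ (hV R hR)
    refine Set.pi_mono fun i _ => ?_
    rw [← DyadicInterval.dilate_one]
    have h := hone R
    have hl := (R i).length_pos
    exact Set.Ico_subset_Ico (by nlinarith) (by nlinarith)
  · calc volume (⋃ P ∈ S, P.dilate 3)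
        ≤ 3 ^ d * volume (DyadicRect.shadow S) := DyadicRect.volume_biUnion_dilate_three_le S
      _ ≤ 3 ^ d * volume (DyadicRect.enlargement U d) := by
          gcongr
          exact Set.iUnion₂_subset fun P hP => hP
      _ ≤ 3 ^ d * (c ^ d * volume (DyadicRect.shadow U)) := by
          gcongr
          exact DyadicRect.volume_enlargement_le U d
      _ ≤ (3 ^ d * c ^ d + d * (c * σ)) * volume (DyadicRect.shadow U) := by
          rw [← mul_assoc]
          gcongr
          exact le_self_add
  · intro U' hU'
    have hlevel : ∀ (j : Fin d) (v : ℕ),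
        ∑' I : DyadicInterval, volume
            (DyadicRect.levelUnion (fun R => (2 : ℝ) ^ N R) sel I j v U') ≤
          c * (s v * volume (DyadicRect.shadow U')) := by
      intro j v
      set W : Set (DyadicRect d) := {R | R ∈ U' ∧ N R = v ∧ sel R = j} with hW
      have hWU : W ⊆ U' := fun R hR => hR.1
      calc ∑' I : DyadicInterval, volume
            (DyadicRect.levelUnion (fun R => (2 : ℝ) ^ N R) sel I j v U')
          ≤ ∑' I : DyadicInterval, volume (DyadicRect.shadow {R | R ∈ W ∧ R j = I}) := by
            refine ENNReal.tsum_le_tsum fun I => measure_mono (DyadicRect.shadow_mono ?_)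
            rintro R ⟨hR, ⟨hle, hlt⟩, hI, hj⟩
            -- Since emb is exactly a power of two, the range for emb forces N R = v.
            have hle' := (pow_le_pow_iff_right₀ (one_lt_two (α := ℝ))).1 hle
            have hlt' := (pow_lt_pow_iff_right₀ (one_lt_two (α := ℝ))).1 hlt
            exact ⟨⟨hR, by omega, hj⟩, hI⟩
        _ ≤ c * (((v + 1 : ℕ) : ℝ≥0∞) * ((2 ^ (v + 1)) ^ d * volume (DyadicRect.shadow W))) := by
            -- The raise that fails is the one by v + 1 generations, one beyond the level recorded
            -- in emb.
            refine DyadicRect.tsum_volume_shadow_side_le (U := U) j (v + 1) ?_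
            rintro R ⟨hR, rfl, rfl⟩
            exact ⟨hin R (hU' hR), hout R (hU' hR)⟩
        _ ≤ c * (s v * volume (DyadicRect.shadow U')) := by
            rw [hs, mul_assoc]
            gcongr
            exact DyadicRect.shadow_mono hWU
    calc ∑ j : Fin d, ∑' v : ℕ, ∑' I : DyadicInterval, w v *
            volume (DyadicRect.levelUnion (fun R => (2 : ℝ) ^ N R) sel I j v U')
        ≤ ∑ _j : Fin d, ∑' v : ℕ, w v * s v * (c * volume (DyadicRect.shadow U')) := by
          refine Finset.sum_le_sum fun j _ => ENNReal.tsum_le_tsum fun v => ?_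
          rw [ENNReal.tsum_mul_left]
          calc _ ≤ w v * (c * (s v * volume (DyadicRect.shadow U'))) := by
                gcongr
                exact hlevel j v
            _ = _ := by ring
      _ = d * (c * σ) * volume (DyadicRect.shadow U') := by
          rw [ENNReal.tsum_mul_right, Finset.sum_const, Finset.card_univ, Fintype.card_fin,
            nsmul_eq_mul]
          ring
      _ ≤ (3 ^ d * c ^ d + d * (c * σ)) * volume (DyadicRect.shadow U') := by
          gcongr
          exact le_add_self
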